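/- Consider a single-server queue with an unreliable server (Model 1): the continuous-time Markov chain on $\mathbb N\times\{Up,Down\}$ (number of customers, server status) with transition intensities $(x,\sigma)\to(x+1,\sigma)$: $\lambda$; $(x,Up)\to(x-1,Up)$: $\mu$ (if $x\ge 1$); $(x,Up)\to(x,Down)$: $\alpha$; $(x,Down)\to(x,Up)$: $\beta$; all four parameters are positive. Put $$s_1=(\mu-\lambda-\beta-\alpha)^2+4\alpha\mu,\qquad \gamma_1=\frac{2\lambda}{\lambda+\beta+\mu+\alpha-\sqrt{s_1}},\qquad \gamma=\frac{2\lambda}{\lambda+\beta+\mu+\alpha+\sqrt{s_1}},$$ $$A=\lambda+\beta-\mu-\alpha+\sqrt{s_1},\qquad G=\frac A2+\frac{2\alpha\beta}{A}.$$ Fix $C\ge\lambda+\mu+\alpha+\beta$. The free process is the discrete-time Markov chain on $\mathbb Z\times\{Up,Down\}$ which makes the transitions above, now for every $x\in\mathbb Z$, with probabilities $\lambda/C,\mu/C,\alpha/C,\beta/C$, and otherwise stays in place. The function $h(x,Up)=\gamma_1^{-x}$, $h(x,Down)=\gamma_1^{-x}\,2\beta/A$ is harmonic for it; the twisted free process is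 its $h$-transform. For $\sigma\in\{Up,Down\}$ let $\mathcal H(0,\sigma)$ be the probability that the twisted free process started at $(0,\sigma)$ has a positive first coordinate at all times $n\ge1$. Put $$\tilde d=\frac1C\left(\frac{\lambda+\beta+\mu+\alpha-\sqrt{s_1}}{2}-\frac1G\cdot\lambda\mu\cdot\frac{A}{\lambda+\beta+\mu+\alpha-\sqrt{s_1}}\right),$$ $$\eta=\sum_{\sigma}\pi(0,\sigma)h(0,\sigma)\mathcal H(0,\sigma),\qquad C^{(1)}(Up)=\frac{\eta}{\tilde d}\cdot\frac1G\cdot\frac A2,$$ where $\pi=\pi_\alpha$ is the stationary distribution of Model 1. Let $\lambda,\mu,\beta>0$ with $\mu>\lambda+\beta$. For every $\alpha>0$ with $\lambda<\frac{\beta}{\alpha+\beta}\mu$, Model 1 has a unique stationary distribution $\pi=\pi_\alpha$. There is a function $\alpha\mapsto C(Up)=C_\alpha(Up)$ such that for all these $\alpha$ (and all $C\geq\lambda+\mu+\alpha+\beta$) $$C(Up)>0,\qquad \frac{\pi(k,Up)}{C^{(1)}(Up)\gamma_1^k+C(Up)\gamma^k}\longrightarrow 1\quad(k\to\infty),$$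 where $C(Up)$ is the coefficient of $\gamma^k$ in the spectral expansion of $\pi(\cdot,Up)$, that is, for some $w=w_\alpha\in\mathbb R$ one has $\pi(k,Up)=w\gamma_1^k+C(Up)\gamma^k$ for all $k\ge0$. Moreover $$\lim_{k\to\infty}\lim_{\alpha\to0^+}\frac{\pi(k,Up)}{C(Up)\gamma^k}=1,\qquad \lim_{\alpha\to0^+}\gamma=\frac\lambda\mu,$$ where the inner limit exists for every $k$; and the limiting system decays like $(\lambda/\mu)^k$: the limits $\ell_k=\lim_{\alpha\to0^+}\pi(k,Up)$ exist and, for some $c>0$, $\ell_k/(c(\lambda/\mu)^k)\to1$ as $k\to\infty$. -/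

import Mathlib

open Filter Topology MeasureTheory ProbabilityTheory

noncomputable section

namespace UnreliableServer

/-- Status of the server. -/
inductive Status
  | Up
  | Down
  deriving DecidableEq

instance : Fintype Status := ⟨{Status.Up, Status.Down}, fun x => by cases x <;> simp⟩

instance : MeasurableSpace Status := ⊤

instance : DiscreteMeasurableSpace Status := ⟨fun _ => trivial⟩

open Status

/-! ### The single unreliable server queue -/

/-- Transition intensity from state `z` to a different state `w` of the continuous-time Markov
chain (number of customers, status of the server): arrivals `lam`, services `mu` (only in status
`Up` and only when a customer is present), breakdowns `α`, repairs `β`. -/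
def rate (lam mu α β : ℝ) (z w : ℕ × Status) : ℝ :=
  if w.1 = z.1 + 1 ∧ w.2 = z.2 then lam
  else if z.1 = w.1 + 1 ∧ z.2 = Up ∧ w.2 = Up then mu
  else if w.1 = z.1 ∧ z.2 = Up ∧ w.2 = Down then α
  else if w.1 = z.1 ∧ z.2 = Down ∧ w.2 = Up then β
  else 0

/-- `π` is a stationary distribution of the chain: a probability vector which satisfies the global
balance equations `π Q = 0` (the rates are bounded, and all sums over states in the balance
equations have finitely many nonzero terms). -/
structure IsStationary (lam mu α β : ℝ) (π : ℕ × Status → ℝ) : Prop where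
  nonneg : ∀ z, 0 ≤ π z
  hasSum_one : HasSum π 1
  balance : ∀ w, ∑' z, π z * rate lam mu α β z w = π w * ∑' z, rate lam mu α β w z

/-! ### Constants -/

/-- `s₁ = (μ - λ - β - α)² + 4 α μ`. -/
def s1 (lam mu α β : ℝ) : ℝ := (mu - lam - β - α) ^ 2 + 4 * α * mu

/-- `γ₁ = 2 λ / (λ + β + μ + α - √s₁)`. -/
def gamma1 (lam mu α β : ℝ) : ℝ := 2 * lam / (lam + β + mu + α - √(s1 lam mu α β))

/-- `γ = 2 λ / (λ + β + μ + α + √s₁)`. -/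
def gamma (lam mu α β : ℝ) : ℝ := 2 * lam / (lam + β + mu + α + √(s1 lam mu α β))

/-- The constant `G`. -/
def constG (lam mu α β : ℝ) : ℝ :=
  (lam + β - mu - α + √(s1 lam mu α β)) / 2
    + 2 * α * β / (lam + β - mu - α + √(s1 lam mu α β))

/-- Stationary horizontal drift of the twisted free process, with uniformization constant `C`. -/
def drift (lam mu α β C : ℝ) : ℝ :=
  1 / C * ((lam + β + mu + α - √(s1 lam mu α β)) / 2
    - 1 / constG lam mu α β * (lam * mu)
      * ((lam + β - mu - α + √(s1 lam mu α β)) / (lam + β + mu + α - √(s1 lam mu α β))))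

/-! ### The free process and its twist -/

/-- The parameters are positive and `C` is an admissible uniformization constant. -/
structure Admissible (lam mu α β C : ℝ) : Prop where
  lam_pos : 0 < lam
  mu_pos : 0 < mu
  alpha_pos : 0 < α
  beta_pos : 0 < β
  le_C : lam + mu + α + β ≤ C

/-- One-step transition probabilities of the free process on `ℤ × {Up, Down}`: the uniformized
queue with the boundary at `0` removed. -/
def freeProb (lam mu α β C : ℝ) (z w : ℤ × Status) : ℝ :=
  if w.1 = z.1 + 1 ∧ w.2 = z.2 then lam / C
  else if w.1 = z.1 - 1 ∧ z.2 = Up ∧ w.2 = Up then mu / C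
  else if w.1 = z.1 ∧ z.2 = Up ∧ w.2 = Down then α / C
  else if w.1 = z.1 ∧ z.2 = Down ∧ w.2 = Up then β / C
  else if w.1 = z.1 ∧ z.2 = Down ∧ w.2 = Down then 1 - (lam + β) / C
  else if w.1 = z.1 ∧ z.2 = Up ∧ w.2 = Up then 1 - (α + mu + lam) / C
  else 0

/-- The harmonic function of the free process. -/
def harm (lam mu α β : ℝ) (z : ℤ × Status) : ℝ :=
  match z.2 with
  | Up => (1 / gamma1 lam mu α β) ^ z.1
  | Down => (1 / gamma1 lam mu α β) ^ z.1
      * (2 * β / (lam + β - mu - α + √(s1 lam mu α β)))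

/-- One-step transition probabilities of the twisted free process (the `h`-transform of the free
process by `harm`). -/
def twistedProb (lam mu α β C : ℝ) (z w : ℤ × Status) : ℝ :=
  freeProb lam mu α β C z w * harm lam mu α β w / harm lam mu α β z

theorem s1_nonneg {lam mu α β C : ℝ} (h : Admissible lam mu α β C) : 0 ≤ s1 lam mu α β := by
  have := mul_pos h.alpha_pos h.mu_pos
  unfold s1
  nlinarith [sq_nonneg (mu - lam - β - α)]

theorem sqrt_lt {lam mu α β C : ℝ} (h : Admissible lam mu α β C) :
    0 < lam + β + mu + α - √(s1 lam mu α β) := by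
  obtain ⟨h1, h2, h3, h4, -⟩ := h
  have : √(s1 lam mu α β) < lam + β + mu + α := by
    rw [Real.sqrt_lt' (by positivity)]
    unfold s1
    nlinarith [mul_pos h2 h1, mul_pos h2 h4]
  linarith

theorem lt_sqrt {lam mu α β C : ℝ} (h : Admissible lam mu α β C) :
    0 < lam + β - mu - α + √(s1 lam mu α β) := by
  have h0 := s1_nonneg h
  obtain ⟨h1, h2, h3, h4, -⟩ := h
  have : mu + α - lam - β < √(s1 lam mu α β) := by
    apply Real.lt_sqrt_of_sq_lt
    unfold s1
    nlinarith [mul_pos h3 h1, mul_pos h3 h4]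
  linarith

theorem gamma1_pos {lam mu α β C : ℝ} (h : Admissible lam mu α β C) :
    0 < gamma1 lam mu α β :=
  div_pos (by linarith [h.lam_pos]) (sqrt_lt h)

theorem harm_pos {lam mu α β C : ℝ} (h : Admissible lam mu α β C) (z : ℤ × Status) :
    0 < harm lam mu α β z := by
  have h1 : 0 < 1 / gamma1 lam mu α β := one_div_pos.mpr (gamma1_pos h)
  have h2 := lt_sqrt h
  have h3 := h.beta_pos
  obtain ⟨x, σ⟩ := z
  cases σ <;> simp only [harm] <;> positivity

theorem freeProb_nonneg {lam mu α β C : ℝ} (h : Admissible lam mu α β C) (z w : ℤ × Status) :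
    0 ≤ freeProb lam mu α β C z w := by
  obtain ⟨h1, h2, h3, h4, h5⟩ := h
  have hC : 0 < C := by linarith
  have e1 : 0 ≤ 1 - (lam + β) / C := by
    rw [sub_nonneg, div_le_one hC]; linarith
  have e2 : 0 ≤ 1 - (α + mu + lam) / C := by
    rw [sub_nonneg, div_le_one hC]; linarith
  unfold freeProb
  split_ifs <;> first | exact e1 | exact e2 | positivity

theorem twistedProb_nonneg {lam mu α β C : ℝ} (h : Admissible lam mu α β C) (z w : ℤ × Status) :
    0 ≤ twistedProb lam mu α β C z w :=
  div_nonneg (mul_nonneg (freeProb_nonneg h z w) (harm_pos h w).le) (harm_pos h z).le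

/-- The states which can be reached from `z` in one step. -/
def nbhd (z : ℤ × Status) : Finset (ℤ × Status) :=
  {(z.1 - 1, Up), (z.1, Up), (z.1, Down), (z.1 + 1, Up), (z.1 + 1, Down)}

theorem twistedProb_eq_zero (lam mu α β C : ℝ) (z w : ℤ × Status) (hw : w ∉ nbhd z) :
    twistedProb lam mu α β C z w = 0 := by
  obtain ⟨x, σ⟩ := z
  obtain ⟨y, τ⟩ := w
  have : freeProb lam mu α β C (x, σ) (y, τ) = 0 := by
    cases σ <;> cases τ <;> simp_all [nbhd, freeProb]
  simp [twistedProb, this]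

theorem sum_twistedProb {lam mu α β C : ℝ} (h : Admissible lam mu α β C) (z : ℤ × Status) :
    ∑ w ∈ nbhd z, twistedProb lam mu α β C z w = 1 := by
  have hg := gamma1_pos h
  have hS := sqrt_lt h
  have hA := lt_sqrt h
  have hr : √(s1 lam mu α β) ^ 2 = (mu - lam - β - α) ^ 2 + 4 * α * mu :=
    Real.sq_sqrt (s1_nonneg h)
  obtain ⟨h1, h2, h3, h4, h5⟩ := h
  have hC : 0 < C := by linarith
  have hginv : 1 / gamma1 lam mu α β
      = (lam + β + mu + α - √(s1 lam mu α β)) / (2 * lam) := by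
    rw [gamma1, one_div_div]
  have hu : 0 < 1 / gamma1 lam mu α β := one_div_pos.mpr hg
  obtain ⟨x, σ⟩ := z
  have hux : (1 / gamma1 lam mu α β) ^ x ≠ 0 := (zpow_pos hu x).ne'
  have hmem1 : (x - 1, Up) ∉ ({(x, Up), (x, Down), (x + 1, Up), (x + 1, Down)} :
      Finset (ℤ × Status)) := by
    simp only [Finset.mem_insert, Finset.mem_singleton, Prod.mk.injEq]
    omega
  rw [nbhd, Finset.sum_insert hmem1, Finset.sum_insert (by simp), Finset.sum_insert (by simp),
    Finset.sum_insert (by simp), Finset.sum_singleton]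
  cases σ
  · have e1 : ¬ (x - 1 = x + 1) := by omega
    have e2 : ¬ (x = x - 1) := by omega
    have hginv' : (1 / gamma1 lam mu α β)⁻¹
        = 2 * lam / (lam + β + mu + α - √(s1 lam mu α β)) := by rw [hginv, inv_div]
    simp only [twistedProb, freeProb, harm, zpow_sub_one₀ hu.ne', zpow_add_one₀ hu.ne', hginv']
    simp [e1, e2, -one_div]
    generalize (1 / gamma1 lam mu α β) ^ x = X at *
    rw [hginv]
    generalize √(s1 lam mu α β) = r at *
    field_simp
    linear_combination (r + (lam - β - mu - α)) * hr
  · have e1 : ¬ (x - 1 = x + 1) := by omega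
    simp only [twistedProb, freeProb, harm, zpow_sub_one₀ hu.ne', zpow_add_one₀ hu.ne']
    simp [e1, -one_div]
    generalize (1 / gamma1 lam mu α β) ^ x = X at *
    rw [hginv]
    generalize √(s1 lam mu α β) = r at *
    field_simp
    ring

/-- Law of one step of the twisted free process from `z`. -/
def twistedStep {lam mu α β C : ℝ} (h : Admissible lam mu α β C) (z : ℤ × Status) :
    PMF (ℤ × Status) :=
  PMF.ofFinset (fun w => ENNReal.ofReal (twistedProb lam mu α β C z w)) (nbhd z)
    (by rw [← ENNReal.ofReal_sum_of_nonneg fun w _ => twistedProb_nonneg h z w,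
      sum_twistedProb h z, ENNReal.ofReal_one])
    (fun w hw => by rw [twistedProb_eq_zero lam mu α β C z w hw, ENNReal.ofReal_zero])

/-- Transition kernel of the twisted free process. -/
def twistedKernel {lam mu α β C : ℝ} (h : Admissible lam mu α β C) :
    Kernel (ℤ × Status) (ℤ × Status) :=
  Kernel.ofFunOfCountable fun z => (twistedStep h z).toMeasure

instance {lam mu α β C : ℝ} (h : Admissible lam mu α β C) : IsMarkovKernel (twistedKernel h) :=
  ⟨fun z => PMF.toMeasure.isProbabilityMeasure (twistedStep h z)⟩

/-- The twisted kernel, applied to the last state of a trajectory up to time `n`. -/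
def twistedHistoryKernel {lam mu α β C : ℝ} (h : Admissible lam mu α β C) (n : ℕ) :
    Kernel ((_ : Finset.Iic n) → ℤ × Status) (ℤ × Status) :=
  (twistedKernel h).comap (fun x => x ⟨n, Finset.mem_Iic.mpr le_rfl⟩) (measurable_pi_apply _)

instance {lam mu α β C : ℝ} (h : Admissible lam mu α β C) (n : ℕ) :
    IsMarkovKernel (twistedHistoryKernel h n) := by
  unfold twistedHistoryKernel
  infer_instance

/-- Law of the whole trajectory of the twisted free process started from `z`. -/
def twistedLaw {lam mu α β C : ℝ} (h : Admissible lam mu α β C) (z : ℤ × Status) :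
    Measure (ℕ → ℤ × Status) :=
  Kernel.traj (X := fun _ => ℤ × Status) (twistedHistoryKernel h) 0 (fun _ => z)

/-- Probability that the twisted free process started from `z` is, at every time `n ≥ 1`, in a
state `(x, σ)` with `x ≥ 1`, that is, that after time `0` it never hits the complement of
`E \ Δ`, where `E = ℕ × {Up, Down}` and the boundary `Δ` consists of `(0, Up)` and `(0, Down)`. -/
def escapeProb {lam mu α β C : ℝ} (h : Admissible lam mu α β C) (z : ℤ × Status) : ℝ :=
  (twistedLaw h z).real {ω | ∀ n : ℕ, 1 ≤ n → 1 ≤ (ω n).1}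

/-- `η = ∑_{(x, σ) ∈ Δ} π(x, σ) h(x, σ) H(x, σ)` with `Δ = {(0, Up), (0, Down)}`. -/
def eta {lam mu α β C : ℝ} (h : Admissible lam mu α β C) (π : ℕ × Status → ℝ) : ℝ :=
  ∑ σ : Status, π (0, σ) * harm lam mu α β (0, σ) * escapeProb h (0, σ)

/-- The constant `C⁽¹⁾(Up)`. -/
def C1Up {lam mu α β C : ℝ} (h : Admissible lam mu α β C) (π : ℕ × Status → ℝ) : ℝ :=
  eta h π / drift lam mu α β C * (1 / constG lam mu α β)
    * ((lam + β - mu - α + √(s1 lam mu α β)) / 2)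

end UnreliableServer

end

/-! Balance across the cut between levels k and k + 1, together with the balance equations in status
Down, gives a two-dimensional linear recursion in the level, whose solution is fixed by π(0,Up). Its
eigenvalues are γ₁ = λ/x and γ = λ/y, where x < y are the roots of X² - (λ+β+μ+α)X + μ(λ+β). Hence
π(k,Up) = π(0,Up)(a γ₁^k + b γ^k) exactly, with a, b the positive constants `coeffLo`, `coeffHi`;
this solution is `baseSol`. Summing the recursion over all levels gives π(0,Up) = β/(α+β) - λ/μ. So
C(Up) = π(0,Up) b.

What remains of the asymptotics is to show that the probabilistically defined C⁽¹⁾(Up) equals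
π(0,Up) a (`C1Up_eq`). This needs the escape probabilities (`escapeProb_eq`), found as in gambler's
ruin: 1/h is harmonic for the h-transform, and from levels x ≥ 1 the half-plane can only be left
through (0,Up), where h = 1. So 1/h is the ruin probability, provided the surviving process escapes
to infinity; this follows from the geometric decay in mean of 1/√h.

As α → 0, μ > λ + β gives x → λ + β and y → μ, so a → 0, b → 1 and π(k,Up) → (1 - λ/μ)(λ/μ)^k. -/

noncomputable section

namespace UnreliableServer

open Status

/-! ### Survival of the twisted process and its killed semigroup. -/

/-- The trajectories which stay in the positive half-plane at the times `1, …, n`. -/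
def survives (n : ℕ) : Set (ℕ → ℤ × Status) := {ω | ∀ m : ℕ, 1 ≤ m → m ≤ n → 1 ≤ (ω m).1}

theorem measurableSet_survives (n : ℕ) : MeasurableSet (survives n) := by
  have : survives n = ⋂ m : ℕ, ⋂ _ : 1 ≤ m, ⋂ _ : m ≤ n, (fun ω => ω m) ⁻¹' {z | 1 ≤ z.1} := by
    ext ω; simp [survives]
  rw [this]
  refine MeasurableSet.iInter fun m => MeasurableSet.iInter fun _ => MeasurableSet.iInter fun _ => ?_
  exact measurable_pi_apply m (MeasurableSet.of_discrete)

section Trajectory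

variable {lam mu α β C : ℝ} (h : Admissible lam mu α β C)

theorem lintegral_twistedKernel (z : ℤ × Status) (f : ℤ × Status → ENNReal) :
    ∫⁻ w, f w ∂(twistedKernel h z)
      = ∑ w ∈ nbhd z, ENNReal.ofReal (twistedProb lam mu α β C z w) * f w := by
  change ∫⁻ w, f w ∂((twistedStep h z).toMeasure) = _
  rw [lintegral_countable']
  have : ∀ w, f w * (twistedStep h z).toMeasure {w}
      = ENNReal.ofReal (twistedProb lam mu α β C z w) * f w := by
    intro w
    rw [PMF.toMeasure_apply_singleton _ _ (measurableSet_singleton w), mul_comm]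
    rfl
  simp_rw [this]
  refine tsum_eq_sum fun w hw => ?_
  rw [twistedProb_eq_zero lam mu α β C z w hw, ENNReal.ofReal_zero, zero_mul]

instance (z : ℤ × Status) : IsProbabilityMeasure (twistedLaw h z) := by
  unfold twistedLaw
  infer_instance

/-- The Markov property at time `n`, for functions of the past and of the next state. -/
theorem lintegral_twistedLaw_succ (z : ℤ × Status) (n : ℕ)
    (F : ((_ : Finset.Iic n) → ℤ × Status) × (ℤ × Status) → ENNReal) (hF : Measurable F) :
    ∫⁻ ω, F (Preorder.frestrictLe n ω, ω (n + 1)) ∂(twistedLaw h z)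
      = ∫⁻ ω, ∑ w ∈ nbhd (ω n), ENNReal.ofReal (twistedProb lam mu α β C (ω n) w)
          * F (Preorder.frestrictLe n ω, w) ∂(twistedLaw h z) := by
  have key := Kernel.partialTraj_compProd_eq_map_traj (X := fun _ => ℤ × Status)
    (κ := twistedHistoryKernel h) (a := 0) (b := n) (Nat.zero_le n) (x₀ := fun _ => z)
  have hm : Measurable fun ω : ℕ → ℤ × Status =>
      ((Preorder.frestrictLe n ω : (_ : Finset.Iic n) → ℤ × Status), ω (n + 1)) := by
    fun_prop
  have e1 := lintegral_map (μ := twistedLaw h z) hF hm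
  rw [← e1]
  change ∫⁻ a, F a ∂((Kernel.traj (X := fun _ => ℤ × Status) (twistedHistoryKernel h) 0
    (fun _ => z)).map _) = _
  rw [← key, Measure.lintegral_compProd hF, ← Kernel.traj_map_frestrictLe_apply, lintegral_map]
  · refine lintegral_congr fun ω => ?_
    exact lintegral_twistedKernel h (ω n) fun w => F (Preorder.frestrictLe n ω, w)
  · exact hF.lintegral_kernel_prod_right'
  · fun_prop

theorem lintegral_twistedLaw_zero (z : ℤ × Status) (f : ℤ × Status → ENNReal) :
    ∫⁻ ω, f (ω 0) ∂(twistedLaw h z) = f z := by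
  have key := Kernel.traj_map_frestrictLe_apply (X := fun _ => ℤ × Status)
    (κ := twistedHistoryKernel h) 0 0 (fun _ => z)
  have hf : Measurable fun y : (_ : Finset.Iic 0) → ℤ × Status =>
      f (y ⟨0, Finset.mem_Iic.mpr le_rfl⟩) :=
    (Measurable.of_discrete (f := f)).comp (measurable_pi_apply _)
  have e1 := lintegral_map (μ := twistedLaw h z) hf
    (Preorder.measurable_frestrictLe (X := fun _ => ℤ × Status) 0)
  refine e1.symm.trans ?_
  unfold twistedLaw
  rw [key, Kernel.partialTraj_self, Kernel.id_apply, lintegral_dirac' _ hf]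

/-- Expectation of `f` at the state at time `n`, on the event of survival up to time `n`. -/
def killedExp (z : ℤ × Status) (n : ℕ) (f : ℤ × Status → ENNReal) : ENNReal :=
  ∫⁻ ω in survives n, f (ω n) ∂(twistedLaw h z)

/-- One step of the twisted free process, killed when it leaves the positive half-plane. -/
def killedStep (lam mu α β C : ℝ) (f : ℤ × Status → ENNReal) (z : ℤ × Status) : ENNReal :=
  ∑ w ∈ nbhd z, ENNReal.ofReal (twistedProb lam mu α β C z w) * if 1 ≤ w.1 then f w else 0

theorem killedExp_zero (z : ℤ × Status) (f : ℤ × Status → ENNReal) :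
    killedExp h z 0 f = f z := by
  have : survives 0 = Set.univ := by
    ext ω; simp only [survives, Set.mem_ofPred_eq, Set.mem_univ, iff_true]; omega
  rw [killedExp, this, Measure.restrict_univ, lintegral_twistedLaw_zero]

/-- Survival up to n + 1 is survival up to n, which depends on the past, and positivity of the next
state, which `killedStep` absorbs; the Markov property does the rest. -/
theorem killedExp_succ (z : ℤ × Status) (n : ℕ) (f : ℤ × Status → ENNReal) :
    killedExp h z (n + 1) f = killedExp h z n (killedStep lam mu α β C f) := by
  classical
  unfold killedExp
  rw [← lintegral_indicator (measurableSet_survives _),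
    ← lintegral_indicator (measurableSet_survives _)]
  let A : Set ((_ : Finset.Iic n) → ℤ × Status) := {y | ∀ m, 1 ≤ m.1 → 1 ≤ (y m).1}
  have hA : ∀ ω : ℕ → ℤ × Status, Preorder.frestrictLe n ω ∈ A ↔ ω ∈ survives n := by
    intro ω
    constructor
    · intro hy m h1 h2
      exact hy ⟨m, Finset.mem_Iic.mpr h2⟩ h1
    · intro hy m h1
      exact hy m.1 h1 (Finset.mem_Iic.mp m.2)
  have hF : Measurable fun p : ((_ : Finset.Iic n) → ℤ × Status) × (ℤ × Status) =>
      if p.1 ∈ A then (if 1 ≤ p.2.1 then f p.2 else 0) else 0 := Measurable.of_discrete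
  have key := lintegral_twistedLaw_succ h z n _ hF
  simp only [hA] at key
  have e : ∀ ω : ℕ → ℤ × Status,
      (survives (n + 1)).indicator (fun ω => f (ω (n + 1))) ω
        = if ω ∈ survives n then (if 1 ≤ (ω (n + 1)).1 then f (ω (n + 1)) else 0) else 0 := by
    intro ω
    have : ω ∈ survives (n + 1) ↔ ω ∈ survives n ∧ 1 ≤ (ω (n + 1)).1 := by
      constructor
      · intro hy
        exact ⟨fun m h1 h2 => hy m h1 (by omega), hy _ (by omega) le_rfl⟩
      · rintro ⟨h1, h2⟩ m h3 h4
        rcases Nat.lt_or_ge n m with h5 | h5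
        · obtain rfl : m = n + 1 := by omega
          exact h2
        · exact h1 m h3 h5
    rw [Set.indicator_apply, if_congr this rfl rfl, ite_and]
  rw [lintegral_congr e, key]
  refine lintegral_congr fun ω => ?_
  by_cases hω : ω ∈ survives n
  · simp [hω, killedStep]
  · simp [hω]

/-- The starting point is exempt from the survival condition and may lie on the boundary, so control
on the positive half-plane alone suffices only from time 1 on. -/
theorem killedExp_congr {z : ℤ × Status} {n : ℕ} (hn : 1 ≤ n) {f g : ℤ × Status → ENNReal}
    (hfg : ∀ w : ℤ × Status, 1 ≤ w.1 → f w = g w) : killedExp h z n f = killedExp h z n g :=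
  setLIntegral_congr_fun (measurableSet_survives n) fun _ hω => hfg _ (hω n hn le_rfl)

theorem killedExp_mono {z : ℤ × Status} {n : ℕ} {f g : ℤ × Status → ENNReal}
    (hfg : ∀ w : ℤ × Status, 1 ≤ w.1 → f w ≤ g w) (hn : 1 ≤ n) :
    killedExp h z n f ≤ killedExp h z n g :=
  setLIntegral_mono' (measurableSet_survives n) fun _ hω => hfg _ (hω n hn le_rfl)

theorem tendsto_survives (z : ℤ × Status) :
    Tendsto (fun n => twistedLaw h z (survives n)) atTop
      (𝓝 (twistedLaw h z {ω | ∀ n : ℕ, 1 ≤ n → 1 ≤ (ω n).1})) := by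
  have : {ω : ℕ → ℤ × Status | ∀ n : ℕ, 1 ≤ n → 1 ≤ (ω n).1} = ⋂ n, survives n := by
    ext ω
    simp only [survives, Set.mem_ofPred_eq, Set.mem_iInter]
    exact ⟨fun h1 n m h2 _ => h1 m h2, fun h1 n h2 => h1 n n h2 le_rfl⟩
  rw [this]
  refine tendsto_measure_iInter_atTop (fun n => (measurableSet_survives n).nullMeasurableSet)
    (fun m n hmn ω hω k h1 h2 => hω k h1 (h2.trans hmn)) ⟨0, measure_ne_top _ _⟩

/-- If `q + p = 1` on the positive half-plane, where `q` is harmonic for the killed process and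
`p` is dominated by a function `t` which decays geometrically in mean, then the probability of
never leaving the positive half-plane is the killed mean of `q` after one step. -/
theorem twistedLaw_survives_eq {q p t : ℤ × Status → ENNReal} {ρ : ENNReal} (hρ : ρ < 1)
    (hqp : ∀ w : ℤ × Status, 1 ≤ w.1 → q w + p w = 1)
    (hq : ∀ w : ℤ × Status, 1 ≤ w.1 → killedStep lam mu α β C q w = q w)
    (hpt : ∀ w : ℤ × Status, 1 ≤ w.1 → p w ≤ t w) (ht : ∀ w, t w ≠ ⊤)
    (htρ : ∀ w : ℤ × Status, killedStep lam mu α β C t w ≤ ρ * t w) (z : ℤ × Status) :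
    twistedLaw h z {ω | ∀ n : ℕ, 1 ≤ n → 1 ≤ (ω n).1} = killedStep lam mu α β C q z := by
  -- The first step is kept apart: `z` may lie on the boundary, where `q` is not assumed harmonic.
  have hqn : ∀ n, killedExp h z (n + 1) q = killedStep lam mu α β C q z := by
    intro n
    induction n with
    | zero => rw [killedExp_succ, killedExp_zero]
    | succ n ih => rw [killedExp_succ, killedExp_congr h (by omega) hq, ih]
  -- Starting this induction at time 0 is possible because `htρ` is assumed at every state, the
  -- boundary included.
  have htn : ∀ n, killedExp h z n t ≤ ρ ^ n * t z := by
    intro n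
    induction n with
    | zero => rw [killedExp_zero]; simp
    | succ n ih =>
      rw [killedExp_succ]
      have h1 : killedExp h z n (killedStep lam mu α β C t) ≤ killedExp h z n fun w => ρ * t w :=
        setLIntegral_mono' (measurableSet_survives n) fun ω _ => htρ _
      have h2 : killedExp h z n (fun w => ρ * t w) = ρ * killedExp h z n t :=
        lintegral_const_mul _ ((Measurable.of_discrete (f := t)).comp (measurable_pi_apply n))
      rw [h2] at h1
      refine h1.trans ((mul_le_mul_right ih ρ).trans_eq ?_)
      rw [pow_succ']; ring
  have hsum : ∀ n, twistedLaw h z (survives (n + 1))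
      = killedStep lam mu α β C q z + killedExp h z (n + 1) p := by
    intro n
    rw [← hqn n]
    unfold killedExp
    have hm : Measurable fun ω : ℕ → ℤ × Status => q (ω (n + 1)) :=
      (Measurable.of_discrete (f := q)).comp (measurable_pi_apply _)
    rw [← lintegral_add_left hm,
      setLIntegral_congr_fun (g := fun _ => 1) (measurableSet_survives (n + 1))
        fun ω hω => hqp _ (hω (n + 1) (by omega) le_rfl)]
    simp
  have hp0 : Tendsto (fun n => killedExp h z (n + 1) p) atTop (𝓝 0) := by
    have hlim : Tendsto (fun n => ρ ^ (n + 1) * t z) atTop (𝓝 0) := by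
      have := ENNReal.Tendsto.mul_const
        ((ENNReal.tendsto_pow_atTop_nhds_zero_of_lt_one hρ).comp (tendsto_add_atTop_nat 1))
        (Or.inr (ht z))
      simpa using this
    exact tendsto_of_tendsto_of_tendsto_of_le_of_le tendsto_const_nhds hlim (fun _ => zero_le)
      fun n => (killedExp_mono h hpt (by omega)).trans (htn (n + 1))
  have hl := (tendsto_survives h z).comp (tendsto_add_atTop_nat 1)
  refine tendsto_nhds_unique hl ?_
  have := (tendsto_const_nhds (x := killedStep lam mu α β C q z)).add hp0
  rw [add_zero] at this
  exact this.congr fun n => (hsum n).symm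

end Trajectory

/-! ### The roots of the characteristic polynomial -/

/-- The smaller root of `x ^ 2 - (λ + β + μ + α) x + μ (λ + β)`. -/
def rootLo (lam mu α β : ℝ) : ℝ := (lam + β + mu + α - √(s1 lam mu α β)) / 2

/-- The larger root of `x ^ 2 - (λ + β + μ + α) x + μ (λ + β)`. -/
def rootHi (lam mu α β : ℝ) : ℝ := (lam + β + mu + α + √(s1 lam mu α β)) / 2

theorem gamma1_eq (lam mu α β : ℝ) : gamma1 lam mu α β = lam / rootLo lam mu α β := by
  rw [gamma1, rootLo, div_div_eq_mul_div, mul_comm]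

theorem gamma_eq (lam mu α β : ℝ) : gamma lam mu α β = lam / rootHi lam mu α β := by
  rw [gamma, rootHi, div_div_eq_mul_div, mul_comm]

theorem rootLo_add_rootHi (lam mu α β : ℝ) :
    rootLo lam mu α β + rootHi lam mu α β = lam + β + mu + α := by
  unfold rootLo rootHi; ring

section Roots

variable {lam mu α β C : ℝ} (h : Admissible lam mu α β C)
include h

theorem rootLo_mul_rootHi :
    rootLo lam mu α β * rootHi lam mu α β = mu * (lam + β) := by
  have hr : √(s1 lam mu α β) ^ 2 = (mu - lam - β - α) ^ 2 + 4 * α * mu :=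
    Real.sq_sqrt (s1_nonneg h)
  unfold rootLo rootHi
  linear_combination (-1 / 4) * hr

theorem rootLo_pos : 0 < rootLo lam mu α β := half_pos (sqrt_lt h)

theorem rootLo_lt : rootLo lam mu α β < lam + β := by
  have := lt_sqrt h
  unfold rootLo; linarith

theorem lt_rootHi : mu < rootHi lam mu α β := by
  have h1 := rootLo_lt h
  have h2 := rootLo_mul_rootHi h
  have h3 := rootLo_pos h
  have h4 := h.mu_pos
  by_contra! h5
  nlinarith

/-- The characteristic polynomial takes the value -αμ < 0 at μ, so its roots lie on opposite sides
of μ. -/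
theorem rootLo_lt_mu : rootLo lam mu α β < mu := by
  have h1 := rootLo_add_rootHi lam mu α β
  have h2 := rootLo_mul_rootHi h
  have h3 := rootLo_lt h
  have h4 := lt_rootHi h
  have h5 := rootLo_pos h
  have h6 := mul_pos h.alpha_pos h.mu_pos
  by_contra! h7
  nlinarith

theorem rootLo_lt_rootHi : rootLo lam mu α β < rootHi lam mu α β :=
  (rootLo_lt_mu h).trans (lt_rootHi h)

theorem rootLo_quadratic :
    (mu - rootLo lam mu α β) * (lam + β - rootLo lam mu α β) = α * rootLo lam mu α β := by
  have h1 := rootLo_add_rootHi lam mu α β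
  have h2 := rootLo_mul_rootHi h
  linear_combination rootLo lam mu α β * h1 - h2

/-- At λ the characteristic polynomial equals βμ - λ(α+β), which stability makes positive; as λ < μ
lies below the larger root, it lies below the smaller one too. This is what makes γ₁ < 1. -/
theorem lt_rootLo (hst : lam < β / (α + β) * mu) : lam < rootLo lam mu α β := by
  have h1 := rootLo_add_rootHi lam mu α β
  have h2 := rootLo_mul_rootHi h
  have h3 := rootLo_lt h
  have h4 := lt_rootHi h
  obtain ⟨p1, p2, p3, p4, -⟩ := h
  have h5 : lam * (α + β) < β * mu := by
    rw [div_mul_eq_mul_div, lt_div_iff₀ (by positivity)] at hst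
    exact hst
  have h6 : lam < mu := by nlinarith
  by_contra! h7
  nlinarith [mul_nonneg (sub_nonneg.mpr h7) (sub_nonneg.mpr (h6.le.trans h4.le))]

end Roots

/-! ### Escape probabilities of the twisted free process -/

theorem sum_freeProb {lam mu α β C : ℝ} (z : ℤ × Status) :
    ∑ w ∈ nbhd z, freeProb lam mu α β C z w = 1 := by
  obtain ⟨x, σ⟩ := z
  have hmem : (x - 1, Up) ∉ ({(x, Up), (x, Down), (x + 1, Up), (x + 1, Down)} :
      Finset (ℤ × Status)) := by
    simp only [Finset.mem_insert, Finset.mem_singleton, Prod.mk.injEq]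
    omega
  rw [nbhd, Finset.sum_insert hmem, Finset.sum_insert (by simp), Finset.sum_insert (by simp),
    Finset.sum_insert (by simp), Finset.sum_singleton]
  have e1 : ¬ (x - 1 = x + 1) := by omega
  have e2 : ¬ (x = x - 1) := by omega
  cases σ <;> simp [freeProb, e1, e2] <;> ring

theorem freeProb_right (lam mu α β C : ℝ) (x : ℤ) (σ : Status) :
    freeProb lam mu α β C (x, σ) (x + 1, σ) = lam / C := by
  simp [freeProb]

section Escape

variable {lam mu α β C : ℝ} (h : Admissible lam mu α β C)
include h

/-- The reciprocal of `harm` is harmonic for the twisted process. -/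
theorem sum_twistedProb_inv_harm (z : ℤ × Status) :
    ∑ w ∈ nbhd z, twistedProb lam mu α β C z w * (harm lam mu α β w)⁻¹
      = (harm lam mu α β z)⁻¹ := by
  have : ∀ w, twistedProb lam mu α β C z w * (harm lam mu α β w)⁻¹
      = freeProb lam mu α β C z w * (harm lam mu α β z)⁻¹ := by
    intro w
    have := (harm_pos h w).ne'
    rw [twistedProb]
    field_simp
  simp_rw [this]
  rw [← Finset.sum_mul, sum_freeProb, one_mul]

theorem harm_right (x : ℤ) (σ : Status) :
    harm lam mu α β (x + 1, σ) = harm lam mu α β (x, σ) / gamma1 lam mu α β := by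
  have := gamma1_pos h
  cases σ <;> simp only [harm, zpow_add_one₀ (one_div_pos.mpr this).ne'] <;> ring

/-- The factor in status Down is β/(λ+β-x) with x = `rootLo`, so both factors are at least 1 as soon
as λ ≤ x. -/
theorem one_le_harm (hst : lam < rootLo lam mu α β) {z : ℤ × Status} (hz : 0 ≤ z.1) :
    1 ≤ harm lam mu α β z := by
  have hg : 1 ≤ 1 / gamma1 lam mu α β := by
    rw [gamma1_eq, one_div_div, one_le_div h.lam_pos]
    exact hst.le
  have h1 := one_le_zpow₀ hg hz
  have hA := lt_sqrt h
  have h2 : 1 ≤ 2 * β / (lam + β - mu - α + √(s1 lam mu α β)) := by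
    rw [one_le_div hA]
    unfold rootLo at hst
    linarith
  obtain ⟨x, σ⟩ := z
  cases σ
  · exact h1
  · exact one_le_mul_of_one_le_of_one_le h1 h2

omit h in
theorem harm_zero_up (lam mu α β : ℝ) : harm lam mu α β (0, Up) = 1 := by
  simp [harm]

theorem killedStep_ofReal {f : ℤ × Status → ℝ} (hf : ∀ w : ℤ × Status, 1 ≤ w.1 → 0 ≤ f w)
    (z : ℤ × Status) :
    killedStep lam mu α β C (fun w => ENNReal.ofReal (f w)) z
      = ENNReal.ofReal (∑ w ∈ nbhd z, twistedProb lam mu α β C z w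
          * if 1 ≤ w.1 then f w else 0) := by
  have hnn : ∀ w : ℤ × Status, 0 ≤ if 1 ≤ w.1 then f w else 0 := by
    intro w
    split_ifs with hw
    · exact hf w hw
    · exact le_rfl
  rw [ENNReal.ofReal_sum_of_nonneg fun w _ => mul_nonneg (twistedProb_nonneg h z w) (hnn w)]
  refine Finset.sum_congr rfl fun w _ => ?_
  rw [ENNReal.ofReal_mul (twistedProb_nonneg h z w)]
  split_ifs <;> simp

/-- `1 - 1 / harm` is harmonic for the twisted process killed outside the positive half-plane. -/
theorem sum_killed_harmonic {z : ℤ × Status} (hz : 1 ≤ z.1) :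
    ∑ w ∈ nbhd z, twistedProb lam mu α β C z w
        * (if 1 ≤ w.1 then 1 - (harm lam mu α β w)⁻¹ else 0)
      = 1 - (harm lam mu α β z)⁻¹ := by
  have hz' : 1 - (harm lam mu α β z)⁻¹ = ∑ w ∈ nbhd z, (twistedProb lam mu α β C z w
      - twistedProb lam mu α β C z w * (harm lam mu α β w)⁻¹) := by
    rw [Finset.sum_sub_distrib, sum_twistedProb h z, sum_twistedProb_inv_harm h z]
  rw [hz']
  refine Finset.sum_congr rfl fun w hw => ?_
  split_ifs with h1
  · ring
  · obtain ⟨x, σ⟩ := z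
    -- Only a service moves to the left, and it keeps the status Up. So the only exit state is
    -- (0,Up), where 1 - 1/h vanishes and killing costs nothing.
    have hw' : w = (0, Up) := by
      simp only [nbhd, Finset.mem_insert, Finset.mem_singleton] at hw
      rcases hw with rfl | rfl | rfl | rfl | rfl <;> simp_all <;> omega
    rw [hw', harm_zero_up]
    simp

/-- The reciprocal square root of `harm` decays geometrically in mean along the twisted
process. -/
theorem sum_twistedProb_inv_sqrt_harm_le (z : ℤ × Status) :
    ∑ w ∈ nbhd z, twistedProb lam mu α β C z w * (√(harm lam mu α β w))⁻¹
      ≤ (1 - lam / C / gamma1 lam mu α β * (1 - √(gamma1 lam mu α β)) ^ 2 / 2)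
        * (√(harm lam mu α β z))⁻¹ := by
  have hg := gamma1_pos h
  have hz := harm_pos h z
  have hsz := Real.sqrt_pos.mpr hz
  set s := √(harm lam mu α β z) with hs
  have hss : s ^ 2 = harm lam mu α β z := Real.sq_sqrt hz.le
  -- With M the mean of s/√h(w), expanding the square gives 1 - 2M + s² E[1/h(w)], and the last term
  -- is 1 by harmonicity of 1/h. Any positive lower bound for the square thus pushes M below 1.
  have h1 : ∑ w ∈ nbhd z, twistedProb lam mu α β C z w * (1 - s * (√(harm lam mu α β w))⁻¹) ^ 2
      = 2 - 2 * s * ∑ w ∈ nbhd z, twistedProb lam mu α β C z w * (√(harm lam mu α β w))⁻¹ := by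
    have : ∀ w, twistedProb lam mu α β C z w * (1 - s * (√(harm lam mu α β w))⁻¹) ^ 2
        = twistedProb lam mu α β C z w
          - 2 * s * (twistedProb lam mu α β C z w * (√(harm lam mu α β w))⁻¹)
          + s ^ 2 * (twistedProb lam mu α β C z w * (harm lam mu α β w)⁻¹) := by
      intro w
      have h2 : (√(harm lam mu α β w))⁻¹ ^ 2 = (harm lam mu α β w)⁻¹ := by
        rw [inv_pow, Real.sq_sqrt (harm_pos h w).le]
      rw [← h2]; ring
    simp_rw [this]
    rw [Finset.sum_add_distrib, Finset.sum_sub_distrib, ← Finset.mul_sum, ← Finset.mul_sum,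
      sum_twistedProb h, sum_twistedProb_inv_harm h, hss, mul_inv_cancel₀ hz.ne']
    ring
  -- The jump to the right alone suffices: its twisted probability is λ/(Cγ₁), and it multiplies
  -- 1/√h by √γ₁.
  have h2 : lam / C / gamma1 lam mu α β * (1 - √(gamma1 lam mu α β)) ^ 2
      ≤ ∑ w ∈ nbhd z, twistedProb lam mu α β C z w
        * (1 - s * (√(harm lam mu α β w))⁻¹) ^ 2 := by
    have hmem : (z.1 + 1, z.2) ∈ nbhd z := by
      obtain ⟨x, σ⟩ := z
      cases σ <;> simp [nbhd]
    refine le_trans (le_of_eq ?_) (Finset.single_le_sum (fun w _ =>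
      mul_nonneg (twistedProb_nonneg h z w) (sq_nonneg _)) hmem)
    obtain ⟨x, σ⟩ := z
    have h3 : s * (√(harm lam mu α β (x + 1, σ)))⁻¹ = √(gamma1 lam mu α β) := by
      rw [harm_right h, Real.sqrt_div hz.le, ← hs, inv_div, mul_div_cancel₀ _ hsz.ne']
    dsimp only
    rw [h3, twistedProb, freeProb_right, harm_right h]
    field_simp
  rw [← div_eq_mul_inv, le_div_iff₀ hsz]
  nlinarith

/-- The escape probability is the twisted probability of a jump to the right, followed by
survival of the twisted process. -/
theorem escapeProb_eq (hst : lam < rootLo lam mu α β) (σ : Status) :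
    escapeProb h (0, σ)
      = lam / C * (harm lam mu α β (1, σ) - 1) / harm lam mu α β (0, σ) := by
  have hg := gamma1_pos h
  have hC : 0 < C := by
    have := h.le_C
    linarith [h.lam_pos, h.mu_pos, h.alpha_pos, h.beta_pos]
  have hinv : ∀ w : ℤ × Status, 1 ≤ w.1 → (harm lam mu α β w)⁻¹ ≤ 1 := fun w hw =>
    inv_le_one_of_one_le₀ (one_le_harm h hst (by omega))
  have hq0 : ∀ w : ℤ × Status, 1 ≤ w.1 → 0 ≤ 1 - (harm lam mu α β w)⁻¹ := fun w hw =>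
    sub_nonneg.mpr (hinv w hw)
  have hp0 : ∀ w, 0 ≤ (harm lam mu α β w)⁻¹ := fun w => (inv_pos.mpr (harm_pos h w)).le
  have ht0 : ∀ w, 0 ≤ (√(harm lam mu α β w))⁻¹ := fun w => inv_nonneg.mpr (Real.sqrt_nonneg _)
  have hρ : 1 - lam / C / gamma1 lam mu α β * (1 - √(gamma1 lam mu α β)) ^ 2 / 2 < 1 := by
    have hlt : √(gamma1 lam mu α β) < 1 := by
      rw [Real.sqrt_lt' one_pos, gamma1_eq, one_pow, div_lt_one (rootLo_pos h)]
      exact hst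
    have h1 : 0 < 1 - √(gamma1 lam mu α β) := sub_pos.mpr hlt
    have := h.lam_pos
    have : 0 < lam / C / gamma1 lam mu α β * (1 - √(gamma1 lam mu α β)) ^ 2 / 2 := by positivity
    linarith
  -- Here 1 - 1/h is the survival probability and 1/h the ruin probability; since h ≥ 1 on the
  -- half-plane, the latter is dominated by the decaying 1/√h.
  have key := twistedLaw_survives_eq h
    (q := fun w => ENNReal.ofReal (1 - (harm lam mu α β w)⁻¹))
    (p := fun w => ENNReal.ofReal (harm lam mu α β w)⁻¹)
    (t := fun w => ENNReal.ofReal (√(harm lam mu α β w))⁻¹)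
    (ρ := ENNReal.ofReal (1 - lam / C / gamma1 lam mu α β * (1 - √(gamma1 lam mu α β)) ^ 2 / 2))
    (by rwa [ENNReal.ofReal_lt_one])
    (fun w hw => by
      rw [← ENNReal.ofReal_add (hq0 w hw) (hp0 w), sub_add_cancel, ENNReal.ofReal_one])
    (fun w hw => by rw [killedStep_ofReal h hq0, sum_killed_harmonic h hw])
    (fun w hw => by
      refine ENNReal.ofReal_le_ofReal (inv_anti₀ (Real.sqrt_pos.mpr (harm_pos h w)) ?_)
      have := one_le_harm h hst (z := w) (by omega)
      exact Real.sqrt_le_iff.mpr ⟨by linarith, by nlinarith⟩)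
    (fun w => ENNReal.ofReal_ne_top)
    (fun w => by
      rw [killedStep_ofReal h fun w _ => ht0 w, ← ENNReal.ofReal_mul' (ht0 w)]
      refine ENNReal.ofReal_le_ofReal (le_trans (Finset.sum_le_sum fun v _ => ?_)
        (sum_twistedProb_inv_sqrt_harm_le h w))
      refine mul_le_mul_of_nonneg_left ?_ (twistedProb_nonneg h w v)
      split_ifs
      · exact le_rfl
      · exact ht0 v)
    (0, σ)
  have hmem : ((1, σ) : ℤ × Status) ∈ nbhd (0, σ) := by cases σ <;> simp [nbhd]
  -- From (0,σ) an arrival is the only way into the positive half-plane, so a single term survives.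
  have hval : ∑ w ∈ nbhd (0, σ), twistedProb lam mu α β C (0, σ) w
        * (if 1 ≤ w.1 then 1 - (harm lam mu α β w)⁻¹ else 0)
      = lam / C * (harm lam mu α β (1, σ) - 1) / harm lam mu α β (0, σ) := by
    rw [Finset.sum_eq_single_of_mem _ hmem]
    · have h1 := (harm_pos h (1, σ)).ne'
      have h2 := freeProb_right lam mu α β C 0 σ
      rw [zero_add] at h2
      rw [if_pos (by simp), twistedProb, h2]
      field_simp
    · intro w hw hne
      obtain ⟨y, τ⟩ := w
      have : ¬ (1 ≤ y) ∨ freeProb lam mu α β C (0, σ) (y, τ) = 0 := by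
        by_cases hy : 1 ≤ y
        · right
          have hy1 : y = 1 := by
            simp only [nbhd, Finset.mem_insert, Finset.mem_singleton, Prod.mk.injEq] at hw
            omega
          subst hy1
          have hτ : τ ≠ σ := fun hτ => hne (by rw [hτ])
          simp [freeProb, hτ]
        · exact Or.inl hy
      rcases this with hy | hy
      · rw [if_neg hy, mul_zero]
      · rw [twistedProb, hy]; simp
  have hnn : 0 ≤ lam / C * (harm lam mu α β (1, σ) - 1) / harm lam mu α β (0, σ) := by
    have h1 := one_le_harm h hst (z := (1, σ)) (by simp)
    have h2 := harm_pos h (0, σ)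
    have h3 := h.lam_pos
    have h4 : 0 ≤ harm lam mu α β (1, σ) - 1 := sub_nonneg.mpr h1
    positivity
  rw [escapeProb, Measure.real, key, killedStep_ofReal h hq0, hval, ENNReal.toReal_ofReal hnn]

end Escape

/-! ### The stationary distribution -/

theorem sum_status (f : Status → ℝ) : ∑ σ, f σ = f Up + f Down := by
  change ∑ σ ∈ {Up, Down}, f σ = _
  rw [Finset.sum_pair (by decide)]

/-- A balance equation only sees neighbouring levels, so its sums reduce to a window of three
levels. -/
theorem tsum_near (F : ℕ × Status → ℝ) (k : ℕ)
    (hF : ∀ z : ℕ × Status, z.1 ≠ k → z.1 ≠ k + 1 → z.1 ≠ k + 2 → F z = 0) :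
    ∑' z, F z = (F (k, Up) + F (k, Down)) + (F (k + 1, Up) + F (k + 1, Down))
      + (F (k + 2, Up) + F (k + 2, Down)) := by
  rw [tsum_eq_sum (s := ({k, k + 1, k + 2} : Finset ℕ) ×ˢ (Finset.univ : Finset Status))]
  · rw [Finset.sum_product, Finset.sum_insert (by simp), Finset.sum_insert (by simp),
      Finset.sum_singleton]
    simp only [sum_status]
    ring
  · intro z hz
    simp only [Finset.mem_product, Finset.mem_insert, Finset.mem_singleton, Finset.mem_univ,
      and_true, not_or] at hz
    exact hF z hz.1 hz.2.1 hz.2.2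

theorem rate_eq_zero (lam mu α β : ℝ) {z w : ℕ × Status} (h1 : z.1 ≠ w.1) (h2 : z.1 ≠ w.1 + 1)
    (h3 : w.1 ≠ z.1 + 1) : rate lam mu α β z w = 0 := by
  unfold rate
  rw [if_neg (fun h => h3 h.1), if_neg (fun h => h2 h.1), if_neg (fun h => h1 h.1.symm),
    if_neg (fun h => h1 h.1.symm)]

section Balance

variable (lam mu α β : ℝ) (π : ℕ × Status → ℝ) (k : ℕ)

theorem inflow_zero_up : ∑' z, π z * rate lam mu α β z (0, Up)
    = π (1, Up) * mu + π (0, Down) * β := by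
  rw [tsum_near _ 0 fun z h1 h2 h3 => by
    rw [rate_eq_zero _ _ _ _ h1 (by simpa using h2) (by simp), mul_zero]]
  simp [rate]
  ring

theorem inflow_zero_down : ∑' z, π z * rate lam mu α β z (0, Down) = π (0, Up) * α := by
  rw [tsum_near _ 0 fun z h1 h2 h3 => by
    rw [rate_eq_zero _ _ _ _ h1 (by simpa using h2) (by simp), mul_zero]]
  simp [rate]

theorem inflow_succ_up : ∑' z, π z * rate lam mu α β z (k + 1, Up)
    = π (k, Up) * lam + π (k + 2, Up) * mu + π (k + 1, Down) * β := by
  rw [tsum_near _ k fun z h1 h2 h3 => by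
    rw [rate_eq_zero _ _ _ _ h2 h3 (by simpa using h1.symm), mul_zero]]
  simp [rate]
  ring

theorem inflow_succ_down : ∑' z, π z * rate lam mu α β z (k + 1, Down)
    = π (k, Down) * lam + π (k + 1, Up) * α := by
  rw [tsum_near _ k fun z h1 h2 h3 => by
    rw [rate_eq_zero _ _ _ _ h2 h3 (by simpa using h1.symm), mul_zero]]
  simp [rate]

theorem outflow_zero_up : ∑' z, rate lam mu α β (0, Up) z = lam + α := by
  rw [tsum_near _ 0 fun z h1 h2 h3 => rate_eq_zero _ _ _ _ h1.symm (by simp) h2]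
  simp [rate]
  ring

theorem outflow_succ_up : ∑' z, rate lam mu α β (k + 1, Up) z = lam + mu + α := by
  rw [tsum_near _ k fun z h1 h2 h3 => rate_eq_zero _ _ _ _ h2.symm (by simpa using h1.symm) h3]
  have hk : k ≠ k + 2 := by omega
  simp [rate, hk]
  ring

theorem outflow_zero_down : ∑' z, rate lam mu α β (0, Down) z = lam + β := by
  rw [tsum_near _ 0 fun z h1 h2 h3 => rate_eq_zero _ _ _ _ h1.symm (by simp) h2]
  simp [rate]
  ring

theorem outflow_succ_down : ∑' z, rate lam mu α β (k + 1, Down) z = lam + β := by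
  rw [tsum_near _ k fun z h1 h2 h3 => rate_eq_zero _ _ _ _ h2.symm (by simpa using h1.symm) h3]
  have hk : k ≠ k + 2 := by omega
  simp [rate, hk]
  ring

end Balance

/-- The cut equations between levels, together with the balance equations in status `Down`. -/
structure CutEquations (lam mu α β : ℝ) (π : ℕ × Status → ℝ) : Prop where
  down_zero : (lam + β) * π (0, Down) = α * π (0, Up)
  down_succ : ∀ k, (lam + β) * π (k + 1, Down) = lam * π (k, Down) + α * π (k + 1, Up)
  cut : ∀ k, mu * π (k + 1, Up) = lam * (π (k, Up) + π (k, Down))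

/-- Summing the balance equations over the levels up to k telescopes to equality of the flows across
the cut; the induction on k carries out this summation. -/
theorem cutEquations_iff {lam mu α β : ℝ} {π : ℕ × Status → ℝ} :
    CutEquations lam mu α β π ↔
      ∀ w, ∑' z, π z * rate lam mu α β z w = π w * ∑' z, rate lam mu α β w z := by
  constructor
  · rintro ⟨h1, h2, h3⟩ ⟨k, σ⟩
    rcases k with _ | k <;> cases σ
    · rw [inflow_zero_up, outflow_zero_up]
      linear_combination h3 0 + h1
    · rw [inflow_zero_down, outflow_zero_down]
      linear_combination -h1
    · rw [inflow_succ_up, outflow_succ_up]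
      linear_combination h3 (k + 1) - h3 k + h2 k
    · rw [inflow_succ_down, outflow_succ_down]
      linear_combination - h2 k
  · intro h
    have h1 : (lam + β) * π (0, Down) = α * π (0, Up) := by
      have := h (0, Down)
      rw [inflow_zero_down, outflow_zero_down] at this
      linear_combination -this
    have h2 : ∀ k, (lam + β) * π (k + 1, Down) = lam * π (k, Down) + α * π (k + 1, Up) := by
      intro k
      have := h (k + 1, Down)
      rw [inflow_succ_down, outflow_succ_down] at this
      linear_combination -this
    refine ⟨h1, h2, fun k => ?_⟩
    induction k with
    | zero =>
      have := h (0, Up)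
      rw [inflow_zero_up, outflow_zero_up] at this
      linear_combination this - h1
    | succ k ih =>
      have := h (k + 1, Up)
      rw [inflow_succ_up, outflow_succ_up] at this
      linear_combination this + ih - h2 k

theorem IsStationary.cutEquations {lam mu α β : ℝ} {π : ℕ × Status → ℝ}
    (hπ : IsStationary lam mu α β π) : CutEquations lam mu α β π :=
  cutEquations_iff.mpr hπ.balance

theorem CutEquations.const_mul {lam mu α β : ℝ} {π : ℕ × Status → ℝ}
    (hπ : CutEquations lam mu α β π) (c : ℝ) : CutEquations lam mu α β fun z => c * π z where
  down_zero := by linear_combination c * hπ.down_zero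
  down_succ k := by linear_combination c * hπ.down_succ k
  cut k := by linear_combination c * hπ.cut k

/-- A solution of the cut equations is determined by its value at `(0, Up)`. -/
theorem CutEquations.ext {lam mu α β : ℝ} (hd : lam + β ≠ 0) (hm : mu ≠ 0)
    {π ρ : ℕ × Status → ℝ} (hπ : CutEquations lam mu α β π) (hρ : CutEquations lam mu α β ρ)
    (h0 : π (0, Up) = ρ (0, Up)) : π = ρ := by
  have key : ∀ k, π (k, Up) = ρ (k, Up) ∧ π (k, Down) = ρ (k, Down) := by
    intro k
    induction k with
    | zero =>
      refine ⟨h0, mul_left_cancel₀ hd ?_⟩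
      rw [hπ.down_zero, hρ.down_zero, h0]
    | succ k ih =>
      have h1 : π (k + 1, Up) = ρ (k + 1, Up) :=
        mul_left_cancel₀ hm (by rw [hπ.cut, hρ.cut, ih.1, ih.2])
      refine ⟨h1, mul_left_cancel₀ hd ?_⟩
      rw [hπ.down_succ, hρ.down_succ, h1, ih.2]
  funext ⟨k, σ⟩
  cases σ
  · exact (key k).1
  · exact (key k).2

/-- The mass at `(0, Up)` of a stationary distribution. -/
theorem IsStationary.zero_up {lam mu α β C : ℝ} (h : Admissible lam mu α β C)
    {π : ℕ × Status → ℝ} (hπ : IsStationary lam mu α β π) :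
    π (0, Up) = β / (α + β) - lam / mu := by
  have hc := hπ.cutEquations
  have hs := hπ.hasSum_one.summable
  have hU : Summable fun k : ℕ => π (k, Up) :=
    hs.comp_injective (i := fun k : ℕ => (k, Up)) fun a b hab => (Prod.mk.inj hab).1
  have hD : Summable fun k : ℕ => π (k, Down) :=
    hs.comp_injective (i := fun k : ℕ => (k, Down)) fun a b hab => (Prod.mk.inj hab).1
  have h1 : ∑' k : ℕ, π (k, Up) + ∑' k : ℕ, π (k, Down) = 1 := by
    rw [← hU.tsum_add hD, ← hπ.hasSum_one.tsum_eq, hs.tsum_prod]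
    simp [tsum_fintype, sum_status]
  have hU' : Summable fun k : ℕ => π (k + 1, Up) :=
    hU.comp_injective (i := fun k : ℕ => k + 1) (add_left_injective 1)
  have e1 := hU.tsum_eq_zero_add
  have e2 := hD.tsum_eq_zero_add
  have e3 : mu * ∑' k : ℕ, π (k + 1, Up)
      = lam * (∑' k : ℕ, π (k, Up) + ∑' k : ℕ, π (k, Down)) := by
    rw [← tsum_mul_left, ← hU.tsum_add hD, ← tsum_mul_left]
    exact tsum_congr hc.cut
  have e4 : (lam + β) * ∑' k : ℕ, π (k + 1, Down)
      = lam * ∑' k : ℕ, π (k, Down) + α * ∑' k : ℕ, π (k + 1, Up) := by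
    rw [← tsum_mul_left, ← tsum_mul_left, ← tsum_mul_left,
      ← (hD.mul_left lam).tsum_add (hU'.mul_left α)]
    exact tsum_congr hc.down_succ
  have e5 := hc.down_zero
  obtain ⟨p1, p2, p3, p4, -⟩ := h
  set U := ∑' k : ℕ, π (k, Up)
  set D := ∑' k : ℕ, π (k, Down)
  -- Summing over levels leaves the balance of the two-state server process; the summed cut
  -- equations below equate throughput and arrival rate.
  have hβD : β * D = α * U := by
    linear_combination e4 + (lam + β) * e2 + e5 - α * e1
  have hUval : U = β / (α + β) := by
    rw [eq_div_iff (by positivity)]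
    linear_combination β * h1 - hβD
  have hr : ∑' k : ℕ, π (k + 1, Up) = lam / mu := by
    rw [eq_div_iff p2.ne']
    linear_combination e3 + lam * h1
  linarith

/-! ### The explicit solution; existence and uniqueness. -/

/-- Coefficient of `gamma1 ^ k` in the normalized solution of the balance equations. -/
def coeffLo (lam mu α β : ℝ) : ℝ :=
  (rootHi lam mu α β - mu) / (rootHi lam mu α β - rootLo lam mu α β)

/-- Coefficient of `gamma ^ k` in the normalized solution of the balance equations. -/
def coeffHi (lam mu α β : ℝ) : ℝ :=
  (mu - rootLo lam mu α β) / (rootHi lam mu α β - rootLo lam mu α β)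

/-- The solution of the balance equations with value `1` at `(0, Up)`. -/
def baseSol (lam mu α β : ℝ) (z : ℕ × Status) : ℝ :=
  match z.2 with
  | Up => coeffLo lam mu α β * gamma1 lam mu α β ^ z.1
      + coeffHi lam mu α β * gamma lam mu α β ^ z.1
  | Down => α * mu / (lam * (rootHi lam mu α β - rootLo lam mu α β))
      * (gamma1 lam mu α β ^ (z.1 + 1) - gamma lam mu α β ^ (z.1 + 1))

section Base

variable {lam mu α β C : ℝ} (h : Admissible lam mu α β C)
include h

theorem coeffLo_pos : 0 < coeffLo lam mu α β :=
  div_pos (sub_pos.mpr (lt_rootHi h)) (sub_pos.mpr (rootLo_lt_rootHi h))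

theorem coeffHi_pos : 0 < coeffHi lam mu α β :=
  div_pos (sub_pos.mpr (rootLo_lt_mu h)) (sub_pos.mpr (rootLo_lt_rootHi h))

theorem gamma_pos : 0 < gamma lam mu α β := by
  rw [gamma_eq]
  exact div_pos h.lam_pos (h.mu_pos.trans (lt_rootHi h))

theorem gamma_lt_gamma1 : gamma lam mu α β < gamma1 lam mu α β := by
  rw [gamma_eq, gamma1_eq]
  exact div_lt_div_of_pos_left h.lam_pos (rootLo_pos h) (rootLo_lt_rootHi h)

theorem baseSol_zero_up : baseSol lam mu α β (0, Up) = 1 := by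
  have := (sub_pos.mpr (rootLo_lt_rootHi h)).ne'
  simp only [baseSol, coeffLo, coeffHi, pow_zero, mul_one]
  field_simp
  ring

theorem baseSol_nonneg (z : ℕ × Status) : 0 ≤ baseSol lam mu α β z := by
  have h1 := (coeffLo_pos h).le
  have h2 := (coeffHi_pos h).le
  have h3 := (gamma_pos h).le
  have h4 := (gamma1_pos h).le
  have h5 := sub_pos.mpr (rootLo_lt_rootHi h)
  obtain ⟨k, σ⟩ := z
  cases σ
  · simp only [baseSol]
    positivity
  · have h6 : 0 ≤ gamma1 lam mu α β ^ (k + 1) - gamma lam mu α β ^ (k + 1) :=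
      sub_nonneg.mpr (pow_le_pow_left₀ h3 (gamma_lt_gamma1 h).le _)
    have h7 := h.lam_pos
    have h8 := h.mu_pos
    have h9 := h.alpha_pos
    simp only [baseSol]
    positivity

theorem baseSol_cutEquations : CutEquations lam mu α β (baseSol lam mu α β) := by
  have hsum := rootLo_add_rootHi lam mu α β
  have hlo := rootLo_pos h
  have hhi := h.mu_pos.trans (lt_rootHi h)
  have hd := sub_pos.mpr (rootLo_lt_rootHi h)
  have hprod := rootLo_mul_rootHi h
  obtain ⟨p1, p2, p3, p4, -⟩ := h
  -- Through the sum and product of the roots, α and β become rational functions of the roots. This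
  -- removes the square root, and the cut equations turn into rational identities.
  have hβ : β = rootLo lam mu α β * rootHi lam mu α β / mu - lam := by
    rw [hprod]; field_simp; ring
  have hα : α = rootLo lam mu α β + rootHi lam mu α β - mu
      - rootLo lam mu α β * rootHi lam mu α β / mu := by
    rw [hprod, hsum]; field_simp; ring
  refine ⟨?_, fun k => ?_, fun k => ?_⟩
  all_goals
    simp only [baseSol, coeffLo, coeffHi, gamma1_eq, gamma_eq, pow_succ, pow_zero]
    generalize rootLo lam mu α β = x at *
    generalize rootHi lam mu α β = y at *
    have hx := hlo.ne'
    have hy := hhi.ne'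
    have hxy := hd.ne'
    clear hsum hprod p3 p4
    subst hβ hα
  · field_simp
    ring
  · generalize (lam / x) ^ k = X
    generalize (lam / y) ^ k = Y
    field_simp
    ring
  · generalize (lam / x) ^ k = X
    generalize (lam / y) ^ k = Y
    field_simp
    ring

theorem baseSol_summable (hst : lam < rootLo lam mu α β) : Summable (baseSol lam mu α β) := by
  have g1 : gamma1 lam mu α β < 1 := by
    rw [gamma1_eq, div_lt_one (rootLo_pos h)]
    exact hst
  have s1 := summable_geometric_of_lt_one (gamma1_pos h).le g1
  have s2 := summable_geometric_of_lt_one (gamma_pos h).le ((gamma_lt_gamma1 h).trans g1)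
  rw [summable_prod_of_nonneg (baseSol_nonneg h)]
  refine ⟨fun k => Summable.of_finite, ?_⟩
  simp only [tsum_fintype, sum_status, baseSol]
  refine ((s1.mul_left _).add (s2.mul_left _)).add (Summable.mul_left _ ?_)
  exact ((summable_nat_add_iff 1).mpr s1).sub ((summable_nat_add_iff 1).mpr s2)

theorem IsStationary.eq_baseSol {π : ℕ × Status → ℝ} (hπ : IsStationary lam mu α β π) :
    π = fun z => π (0, Up) * baseSol lam mu α β z :=
  hπ.cutEquations.ext (by linarith [h.lam_pos, h.beta_pos]) h.mu_pos.ne'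
    ((baseSol_cutEquations h).const_mul _) (by rw [baseSol_zero_up h, mul_one])

theorem existsUnique_isStationary (hst : lam < rootLo lam mu α β) :
    ∃! π : ℕ × Status → ℝ, IsStationary lam mu α β π := by
  have hs := baseSol_summable h hst
  have hS : 0 < ∑' z, baseSol lam mu α β z :=
    hs.tsum_pos (baseSol_nonneg h) (0, Up) (by rw [baseSol_zero_up h]; exact one_pos)
  refine ⟨fun z => (∑' z, baseSol lam mu α β z)⁻¹ * baseSol lam mu α β z, ⟨?_, ?_, ?_⟩, ?_⟩
  · exact fun z => mul_nonneg (inv_pos.mpr hS).le (baseSol_nonneg h z)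
  · have := hs.hasSum.mul_left (∑' z, baseSol lam mu α β z)⁻¹
    rwa [inv_mul_cancel₀ hS.ne'] at this
  · exact cutEquations_iff.mp ((baseSol_cutEquations h).const_mul _)
  · intro ρ hρ
    have h1 := hρ.eq_baseSol h
    have h2 := hρ.hasSum_one.tsum_eq
    rw [h1, tsum_mul_left] at h2
    have h3 : ρ (0, Up) = (∑' z, baseSol lam mu α β z)⁻¹ := eq_inv_of_mul_eq_one_left h2
    rw [h1, h3]

end Base

/-! ### Identification of C⁽¹⁾(Up) with the spectral coefficient. -/

section Coefficient

variable {lam mu α β C : ℝ} (h : Admissible lam mu α β C)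
include h

theorem harm_zero_down :
    harm lam mu α β (0, Down) = β / (lam + β - rootLo lam mu α β) := by
  have hA := lt_sqrt h
  have e : lam + β - mu - α + √(s1 lam mu α β) = 2 * (lam + β - rootLo lam mu α β) := by
    unfold rootLo; ring
  simp only [harm, e, zpow_zero, one_mul]
  rw [mul_div_mul_left _ _ two_ne_zero]

/-- The constant `C⁽¹⁾(Up)` is the coefficient of `gamma1 ^ k` in the spectral expansion. -/
theorem C1Up_eq (hst : lam < rootLo lam mu α β) {π : ℕ × Status → ℝ}
    (hπ : IsStationary lam mu α β π) :
    C1Up h π = π (0, Up) * coeffLo lam mu α β := by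
  have hη : eta h π = lam / C * (π (0, Up) * (rootLo lam mu α β / lam - 1)
      + π (0, Down) * (β / (lam + β - rootLo lam mu α β) * (rootLo lam mu α β / lam) - 1)) := by
    have hr : ∀ σ, harm lam mu α β (1, σ)
        = harm lam mu α β (0, σ) * (rootLo lam mu α β / lam) := by
      intro σ
      have := harm_right h 0 σ
      rw [zero_add] at this
      rw [this, gamma1_eq, div_div_eq_mul_div, mul_div_assoc]
    -- The weight h(0,σ) in η cancels the denominator of the escape probability.
    have hcancel : ∀ σ, π (0, σ) * harm lam mu α β (0, σ) * escapeProb h (0, σ)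
        = lam / C * (π (0, σ) * (harm lam mu α β (0, σ) * (rootLo lam mu α β / lam) - 1)) := by
      intro σ
      have h1 := (harm_pos h (0, σ)).ne'
      rw [escapeProb_eq h hst, hr σ]
      generalize harm lam mu α β (0, σ) = H at *
      field_simp
    rw [eta, sum_status, hcancel, hcancel, harm_zero_up, harm_zero_down h]
    ring
  have hC : 0 < C := by
    have := h.le_C
    linarith [h.lam_pos, h.mu_pos, h.alpha_pos, h.beta_pos]
  have hd := hπ.cutEquations.down_zero
  have hd' : π (0, Down) = α / (lam + β) * π (0, Up) := by
    have : 0 < lam + β := by linarith [h.lam_pos, h.beta_pos]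
    field_simp
    linear_combination hd
  have e1 : lam + β - mu - α + √(s1 lam mu α β) = 2 * (lam + β - rootLo lam mu α β) := by
    unfold rootLo; ring
  have e2 : lam + β + mu + α - √(s1 lam mu α β) = 2 * rootLo lam mu α β := by
    unfold rootLo; ring
  rw [C1Up, hη, hd', drift, constG, coeffLo]
  simp only [e1, e2]
  have hq := rootLo_quadratic h
  have hhi : rootHi lam mu α β = lam + β + mu + α - rootLo lam mu α β := by
    rw [← rootLo_add_rootHi lam mu α β]; ring
  have hx := rootLo_pos h
  have hxm := rootLo_lt_mu h
  have hxb := rootLo_lt h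
  have hlam := h.lam_pos
  have hmu := h.mu_pos
  have hβ := h.beta_pos
  have hα := h.alpha_pos
  rw [hhi]
  generalize π (0, Up) = u
  clear hη hd hd' hhi e1 e2 hπ
  generalize rootLo lam mu α β = x at hst hq hx hxm hxb ⊢
  -- Here a = A/2. Eliminating β by this definition and α by the characteristic equation leaves λ,
  -- μ, x, a as free variables and only rational expressions.
  obtain ⟨a, ha⟩ : ∃ a, a = lam + β - x := ⟨_, rfl⟩
  rw [← ha] at hq ⊢
  have ha0 : 0 < a := by linarith
  obtain rfl : β = a + x - lam := by linarith
  obtain rfl : α = (mu - x) * a / x := by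
    rw [eq_div_iff hx.ne']; exact hq.symm
  have hmx : 0 < mu - x := sub_pos.mpr hxm
  have hxl : 0 < x - lam := sub_pos.mpr hst
  have hK : 0 < a * x + (mu - x) * (a + x - lam) := by positivity
  -- This quantity is x times the gap between the two roots; it also appears in the numerator of the
  -- drift, and the two occurrences match in the final identity.
  have hD : 0 < mu * a + mu * x - x ^ 2 := by nlinarith [mul_pos hmu ha0, mul_pos hx hmx]
  have hG : 2 * a / 2 + 2 * ((mu - x) * a / x) * (a + x - lam) / (2 * a)
      = (a * x + (mu - x) * (a + x - lam)) / x := by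
    field_simp
  have hdrift : 2 * x / 2 - 1 / ((a * x + (mu - x) * (a + x - lam)) / x) * (lam * mu)
        * (2 * a / (2 * x))
      = (x - lam) * (mu * a + mu * x - x ^ 2) / (a * x + (mu - x) * (a + x - lam)) := by
    field_simp
    ring
  have hden : lam + (a + x - lam) + mu + (mu - x) * a / x - x - x
      = (mu * a + mu * x - x ^ 2) / x := by
    field_simp
    ring
  have hnum : lam + (a + x - lam) + mu + (mu - x) * a / x - x - mu = mu * a / x := by
    field_simp
    ring
  have hax : lam + (a + x - lam) = a + x := by ring
  have hax0 : 0 < a + x := by positivity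
  rw [hG, hdrift, hden, hnum, hax]
  field_simp
  ring

end Coefficient

/-! ### The limit of rare breakdowns -/

section Limit

variable {lam mu β : ℝ} (hlarge : lam + β < mu)
include hlarge

/-- At α = 0 the discriminant is a perfect square, and μ > λ + β decides the sign of its root, hence
which root tends to λ + β and which to μ. -/
theorem tendsto_sqrt_s1 :
    Tendsto (fun α => √(s1 lam mu α β)) (𝓝[>] 0) (𝓝 (mu - lam - β)) := by
  have hc : Continuous fun α => √(s1 lam mu α β) := by
    unfold s1; fun_prop
  have := (hc.tendsto 0).mono_left (nhdsWithin_le_nhds (s := Set.Ioi 0))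
  have e : s1 lam mu 0 β = (mu - lam - β) ^ 2 := by unfold s1; ring
  rwa [e, Real.sqrt_sq (by linarith)] at this

theorem tendsto_rootLo :
    Tendsto (fun α => rootLo lam mu α β) (𝓝[>] 0) (𝓝 (lam + β)) := by
  have h1 := tendsto_sqrt_s1 hlarge
  have h2 : Tendsto (fun α : ℝ => α) (𝓝[>] 0) (𝓝 0) := nhdsWithin_le_nhds
  have := ((h2.const_add (lam + β + mu)).sub h1).div_const 2
  rwa [show (lam + β + mu + 0 - (mu - lam - β)) / 2 = lam + β by ring] at this

theorem tendsto_rootHi :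
    Tendsto (fun α => rootHi lam mu α β) (𝓝[>] 0) (𝓝 mu) := by
  have h1 := tendsto_sqrt_s1 hlarge
  have h2 : Tendsto (fun α : ℝ => α) (𝓝[>] 0) (𝓝 0) := nhdsWithin_le_nhds
  have := ((h2.const_add (lam + β + mu)).add h1).div_const 2
  rwa [show (lam + β + mu + 0 + (mu - lam - β)) / 2 = mu by ring] at this

theorem tendsto_gamma (hmu : 0 < mu) :
    Tendsto (fun α => gamma lam mu α β) (𝓝[>] 0) (𝓝 (lam / mu)) := by
  simp only [gamma_eq]
  exact tendsto_const_nhds.div (tendsto_rootHi hlarge) hmu.ne'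

theorem tendsto_gamma1 (hlam : 0 < lam) (hβ : 0 < β) :
    Tendsto (fun α => gamma1 lam mu α β) (𝓝[>] 0) (𝓝 (lam / (lam + β))) := by
  simp only [gamma1_eq]
  exact tendsto_const_nhds.div (tendsto_rootLo hlarge) (by positivity)

/-- For fixed α the term in γ₁^k dominates as k grows, but its coefficient dies with α; this is why
the order of the two limits matters. -/
theorem tendsto_coeffLo :
    Tendsto (fun α => coeffLo lam mu α β) (𝓝[>] 0) (𝓝 0) := by
  have h1 := tendsto_rootHi hlarge
  have h2 := tendsto_rootLo hlarge
  have := (h1.sub_const mu).div (h1.sub h2) (by linarith)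
  rwa [sub_self, zero_div] at this

theorem tendsto_coeffHi :
    Tendsto (fun α => coeffHi lam mu α β) (𝓝[>] 0) (𝓝 1) := by
  have h1 := tendsto_rootHi hlarge
  have h2 := tendsto_rootLo hlarge
  have hne : mu - (lam + β) ≠ 0 := by linarith
  have := (h2.const_sub mu).div (h1.sub h2) hne
  rwa [div_self hne] at this

theorem tendsto_baseSol_up (hlam : 0 < lam) (hmu : 0 < mu) (hβ : 0 < β) (k : ℕ) :
    Tendsto (fun α => baseSol lam mu α β (k, Up)) (𝓝[>] 0) (𝓝 ((lam / mu) ^ k)) := by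
  have := ((tendsto_coeffLo hlarge).mul
    ((tendsto_gamma1 hlarge hlam hβ).pow k)).add
    ((tendsto_coeffHi hlarge).mul ((tendsto_gamma hlarge hmu).pow k))
  rwa [zero_mul, zero_add, one_mul] at this

theorem eventually_stable (hβ : 0 < β) :
    ∀ᶠ α in 𝓝[>] (0 : ℝ), 0 < α ∧ lam < β / (α + β) * mu := by
  refine eventually_mem_nhdsWithin.and ?_
  have h2 : Tendsto (fun α : ℝ => α) (𝓝[>] 0) (𝓝 0) := nhdsWithin_le_nhds
  have h3 : Tendsto (fun α : ℝ => β / (α + β) * mu) (𝓝[>] 0) (𝓝 mu) := by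
    have := ((tendsto_const_nhds (x := β)).div (h2.add_const β) (by simpa using hβ.ne')).mul_const mu
    rwa [zero_add, div_self hβ.ne', one_mul] at this
  exact h3.eventually (lt_mem_nhds (by linarith))

end Limit

end UnreliableServer

end

/-! ### Assembly of the result. -/

theorem proposition2 (lam mu β : ℝ) (hlam : 0 < lam) (hmu : 0 < mu) (hβ : 0 < β)
    (hlarge : lam + β < mu) :
    -- in the stable regime the stationary distribution exists and is unique
    (∀ α : ℝ, 0 < α → lam < β / (α + β) * mu →
      ∃! π : ℕ × UnreliableServer.Status → ℝ, UnreliableServer.IsStationary lam mu α β π) ∧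
    -- `π α` is this stationary distribution for breakdown intensity `α`
    ∀ π : ℝ → ℕ × UnreliableServer.Status → ℝ,
      (∀ α : ℝ, 0 < α → lam < β / (α + β) * mu →
        UnreliableServer.IsStationary lam mu α β (π α)) →
      ∃ CUp : ℝ → ℝ,
        (∀ α : ℝ, ∀ hα : 0 < α, lam < β / (α + β) * mu →
          0 < CUp α ∧
          -- `CUp α` is the coefficient of `γ ^ k` in the spectral expansion of `π(k, Up)`
          (∃ w : ℝ, ∀ k : ℕ, π α (k, UnreliableServer.Status.Up)
            = w * UnreliableServer.gamma1 lam mu α β ^ k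
              + CUp α * UnreliableServer.gamma lam mu α β ^ k) ∧
          -- `π(k, Up) ∼ C⁽¹⁾(Up) γ₁ ^ k + C(Up) γ ^ k`, for every uniformization constant `C`
          (∀ C : ℝ, ∀ hC : lam + mu + α + β ≤ C,
            Tendsto (fun k : ℕ => π α (k, UnreliableServer.Status.Up)
              / (UnreliableServer.C1Up (C := C) ⟨hlam, hmu, hα, hβ, hC⟩ (π α)
                    * UnreliableServer.gamma1 lam mu α β ^ k
                  + CUp α * UnreliableServer.gamma lam mu α β ^ k))
              atTop (𝓝 1))) ∧
        -- the iterated limit: first `α → 0`, then `k → ∞`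
        (∃ L : ℕ → ℝ,
          (∀ k : ℕ, Tendsto (fun α : ℝ => π α (k, UnreliableServer.Status.Up)
            / (CUp α * UnreliableServer.gamma lam mu α β ^ k)) (𝓝[>] 0) (𝓝 (L k))) ∧
          Tendsto L atTop (𝓝 1)) ∧
        -- the limiting system decays like `(λ / μ) ^ k`
        Tendsto (fun α : ℝ => UnreliableServer.gamma lam mu α β) (𝓝[>] 0) (𝓝 (lam / mu)) ∧
        (∃ (l : ℕ → ℝ) (c : ℝ), 0 < c ∧
          (∀ k : ℕ, Tendsto (fun α : ℝ => π α (k, UnreliableServer.Status.Up))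
            (𝓝[>] 0) (𝓝 (l k))) ∧
          Tendsto (fun k : ℕ => l k / (c * (lam / mu) ^ k)) atTop (𝓝 1)) := by
  have hadm : ∀ α : ℝ, 0 < α →
      UnreliableServer.Admissible lam mu α β (lam + mu + α + β) := fun α hα =>
    ⟨hlam, hmu, hα, hβ, le_rfl⟩
  refine ⟨fun α hα hst => UnreliableServer.existsUnique_isStationary (hadm α hα)
    (UnreliableServer.lt_rootLo (hadm α hα) hst), fun π hπ => ?_⟩
  have hzero : ∀ α : ℝ, 0 < α → lam < β / (α + β) * mu →
      π α (0, UnreliableServer.Status.Up) = β / (α + β) - lam / mu := fun α hα hst =>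
    (hπ α hα hst).zero_up (hadm α hα)
  have hzero_pos : ∀ α : ℝ, 0 < α → lam < β / (α + β) * mu →
      0 < π α (0, UnreliableServer.Status.Up) := fun α hα hst => by
    rw [hzero α hα hst, sub_pos, div_lt_iff₀ hmu]
    exact hst
  have hup : ∀ α : ℝ, 0 < α → lam < β / (α + β) * mu → ∀ k : ℕ,
      π α (k, UnreliableServer.Status.Up) = π α (0, UnreliableServer.Status.Up)
        * UnreliableServer.baseSol lam mu α β (k, UnreliableServer.Status.Up) :=
    fun α hα hst k => congrFun ((hπ α hα hst).eq_baseSol (hadm α hα)) _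
  have hexp : ∀ α : ℝ, 0 < α → lam < β / (α + β) * mu → ∀ k : ℕ,
      π α (k, UnreliableServer.Status.Up)
        = π α (0, UnreliableServer.Status.Up) * UnreliableServer.coeffLo lam mu α β
            * UnreliableServer.gamma1 lam mu α β ^ k
          + π α (0, UnreliableServer.Status.Up) * UnreliableServer.coeffHi lam mu α β
            * UnreliableServer.gamma lam mu α β ^ k := fun α hα hst k => by
    rw [hup α hα hst k, UnreliableServer.baseSol]
    ring
  have hstable := UnreliableServer.eventually_stable hlarge hβ
  have hgamma := UnreliableServer.tendsto_gamma hlarge hmu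
  -- The inner limit is already 1 for every k, so `L` is constant; the limits of π(k,Up) form the
  -- geometric law of the queue without breakdowns.
  refine ⟨fun α => π α (0, UnreliableServer.Status.Up) * UnreliableServer.coeffHi lam mu α β,
    fun α hα hst => ⟨mul_pos (hzero_pos α hα hst) (UnreliableServer.coeffHi_pos (hadm α hα)),
      ⟨_, hexp α hα hst⟩, fun C hC => ?_⟩, ⟨fun _ => 1, fun k => ?_, tendsto_const_nhds⟩, hgamma,
    fun k => (1 - lam / mu) * (lam / mu) ^ k, 1 - lam / mu, ?_, fun k => ?_, ?_⟩
  · rw [UnreliableServer.C1Up_eq _ (UnreliableServer.lt_rootLo (hadm α hα) hst) (hπ α hα hst)]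
    -- With C⁽¹⁾(Up) identified, the denominator is π(k,Up) itself and the quotient is identically
    -- 1.
    refine tendsto_const_nhds.congr fun k => ?_
    rw [← hexp α hα hst k, div_self]
    rw [hexp α hα hst k]
    have h1 := hzero_pos α hα hst
    have h2 := UnreliableServer.coeffHi_pos (hadm α hα)
    have h3 := UnreliableServer.coeffLo_pos (hadm α hα)
    have h4 := UnreliableServer.gamma_pos (hadm α hα)
    have h5 := UnreliableServer.gamma1_pos (hadm α hα)
    positivity
  · have hne : (lam / mu) ^ k ≠ 0 := by positivity
    have hlim := (UnreliableServer.tendsto_baseSol_up hlarge hlam hmu hβ k).div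
      ((UnreliableServer.tendsto_coeffHi hlarge).mul (hgamma.pow k))
      (by rwa [one_mul])
    rw [one_mul, div_self hne] at hlim
    refine hlim.congr' ?_
    filter_upwards [hstable] with α hα
    rw [Pi.div_apply, hup α hα.1 hα.2 k, mul_assoc,
      mul_div_mul_left _ _ (hzero_pos α hα.1 hα.2).ne']
  · rw [sub_pos, div_lt_one hmu]
    linarith
  · have h0 : Tendsto (fun α : ℝ => β / (α + β) - lam / mu) (𝓝[>] 0) (𝓝 (1 - lam / mu)) := by
      have hid : Tendsto (fun α : ℝ => α) (𝓝[>] 0) (𝓝 0) := nhdsWithin_le_nhds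
      have := ((tendsto_const_nhds (x := β)).div (hid.add_const β) (by simpa using hβ.ne')).sub_const (lam / mu)
      rwa [zero_add, div_self hβ.ne'] at this
    refine (h0.mul (UnreliableServer.tendsto_baseSol_up hlarge hlam hmu hβ k)).congr' ?_
    filter_upwards [hstable] with α hα
    rw [hup α hα.1 hα.2 k, hzero α hα.1 hα.2]
  · refine tendsto_const_nhds.congr fun k => (div_self ?_).symm
    have : 0 < 1 - lam / mu := by
      rw [sub_pos, div_lt_one hmu]
      linarith
    positivity
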